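/- Let $D$ be a non-empty (unoriented, not necessarily connected) link diagram in the plane or on $S^2$. Let $\langle D\rangle=\sum_{\sigma}A^{a(\sigma)-b(\sigma)}(-A^2-A^{-2})^{|\sigma|-1}\in\mathbb Z[A,A^{-1}]$ be its Kauffman bracket, where $\sigma$ ranges over the Kauffman states of $D$ (choices of the $A$- or the $B$-resolution at each crossing), $a(\sigma)$ and $b(\sigma)$ are the numbers of $A$- and $B$-resolutions in $\sigma$, and $|\sigma|$ is the number of circles of the resolved diagram. Let $\mathbb G_A=\mathbb G_A(D)$ be the all-$A$ state graph: its vertices are the circles of the all-$A$ state, and each crossing $c$ gives an edge, which joins the circles containing the two arcs of the $A$-resolution of $c$. The diagram $D$ is called $A$-adequate if $\mathbb G_A$ has no edge that is a loop. Let $M(D)=e(\mathbb G_A)+2v(\mathbb G_A)-2$, where $e$ and $v$ denote the numbers of edges and vertices, and let $a_M(D)$ be the coefficient of $A^{M(D)}$ in $\langle D\rangle$; it is known that no higher power of $A$ occurs in $\langle D\rangle$. For $n>1$ let $D^n$ be the diagram obtained from $D$ by taking $n$ parallel copies (the blackboard $n$-cable), so that $a_M(D^n)$ is the coefficient of $A^{M(D^n)}$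 in $\langle D^n\rangle$. **Lemma 2.4.** We have $a_M(D^n)\neq 0$ for some $n>1$ if and only if $D$ is $A$-adequate. Equivalently, $D$ is not $A$-adequate if and only if $a_M(D^n)=0$ for all $n>1$. -/

import Mathlib

open scoped LaurentPolynomial

/-- A combinatorial (unoriented) link diagram code with set of crossings `X`, the analogue of a
planar diagram (PD) code.

Every crossing `c` has four half-edges `(c, 0)`, `(c, 1)`, `(c, 2)`, `(c, 3)`, listed in
counterclockwise order around the crossing.  The half-edges `(c, 0)` and `(c, 2)` form the
under-strand and `(c, 1)` and `(c, 3)` form the over-strand.  The fixed-point free involution `arc`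
says which half-edges are joined by the edges of the diagram, and `circles` is the number of
components of the diagram that are simple closed curves without any crossing.

A code is the code of a diagram on the sphere (equivalently, in the plane) exactly if it is planar
in the sense of `LinkDiagram.IsPlanar` below.  For a split diagram the code does not record the
position of the pieces relative to each other; none of the notions below depends on it. -/
structure LinkDiagram (X : Type*) where
  /-- The half-edge at the other end of the edge that starts with a given half-edge. -/
  arc : X × Fin 4 → X × Fin 4
  arc_arc : ∀ d, arc (arc d) = d
  arc_ne : ∀ d, arc d ≠ d
  /-- The number of components without crossings. -/
  circles : ℕ

namespace LinkDiagram

variable {X : Type*}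

/-! ### Planarity -/

/-- The edges of the underlying 4-valent graph: pairs of half-edges joined by `arc`. -/
def Edge (D : LinkDiagram X) : Type _ :=
  Quot fun d d' : X × Fin 4 => d' = D.arc d

/-- The faces of the underlying 4-valent graph: the orbits of half-edges under the face
permutation, which goes along an edge and then to the next half-edge of the crossing
at its end in counterclockwise order. -/
def Face (D : LinkDiagram X) : Type _ :=
  Quot fun d d' : X × Fin 4 => d' = ((D.arc d).1, (D.arc d).2 + 1)

/-- The connected components of the underlying 4-valent graph. -/
def Piece (D : LinkDiagram X) : Type _ :=
  Quot fun d d' : X × Fin 4 => d' = D.arc d ∨ d'.1 = d.1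

/-- The code is planar: the surface obtained from the 4-valent graph by gluing in the faces
has Euler characteristic `2` per connected component, i.e. it is a disjoint union of spheres. -/
def IsPlanar (D : LinkDiagram X) : Prop :=
  Nat.card X + Nat.card D.Face = Nat.card D.Edge + 2 * Nat.card D.Piece

/-- The diagram is not the empty diagram. -/
def IsNonempty (D : LinkDiagram X) : Prop :=
  Nonempty X ∨ 0 < D.circles

/-! ### States, the Kauffman bracket, and the all-`A` state graph -/

/-- The splice of a crossing: it sends each of the four half-edges to the one that it is joined to
by the `A`-resolution (for `true`) or the `B`-resolution (for `false`).  The `A`-resolution merges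
the two regions that the over-strand `1`-`3` sweeps out when it is rotated counterclockwise;
these lie between `1` and `2` and between `3` and `0`, so that `0` is joined
to `1` and `2` to `3`. -/
def splice : Bool → Fin 4 → Fin 4
  | true => ![1, 0, 3, 2]
  | false => ![3, 2, 1, 0]

/-- The circles that result from resolving all crossings of `D` according to the Kauffman state
`σ` (`true` for `A`, `false` for `B`): closed curves made of edges of `D` and of the splices,
together with the components of `D` without crossings. -/
def StateCircle (D : LinkDiagram X) (σ : X → Bool) : Type _ :=
  (Quot fun d d' : X × Fin 4 => d' = D.arc d ∨ d' = (d.1, splice (σ d.1) d.2)) ⊕ Fin D.circles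

/-- The state circle through a given half-edge. -/
def stateCircle (D : LinkDiagram X) (σ : X → Bool) (d : X × Fin 4) : D.StateCircle σ :=
  Sum.inl (Quot.mk _ d)

/-- The Kauffman bracket `⟨D⟩ = ∑ σ, A ^ (a(σ) - b(σ)) * (- A ^ 2 - A ^ (-2)) ^ (|σ| - 1)`, where
`a(σ)` and `b(σ)` are the numbers of `A`- and `B`-resolutions of the state `σ` and `|σ|` is its
number of circles.  The variable `A` is `LaurentPolynomial.T 1`, and the crossingless
diagram of the unknot has bracket `1`. -/
noncomputable def bracket [Fintype X] [DecidableEq X] (D : LinkDiagram X) : ℤ[T;T⁻¹] :=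
  ∑ σ : X → Bool, LaurentPolynomial.T (∑ c : X, if σ c then 1 else -1) *
    (-LaurentPolynomial.T 2 - LaurentPolynomial.T (-2)) ^ (Nat.card (D.StateCircle σ) - 1)

/-- The all-`A` state. -/
def allA : X → Bool := fun _ => true

/-- The vertices of the all-`A` state graph (ribbon graph) `𝔾_A` are the circles of the all-`A`
state.  Its edges are the crossings of `D`. -/
abbrev VertexA (D : LinkDiagram X) : Type _ := D.StateCircle allA

/-- The two ends of the edge of `𝔾_A` given by the crossing `c`: the state circles that contain
the two arcs `0`-`1` and `2`-`3` of the `A`-resolution of `c`. -/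
def endsA (D : LinkDiagram X) (c : X) : D.VertexA × D.VertexA :=
  (D.stateCircle allA (c, 0), D.stateCircle allA (c, 2))

/-- `D` is `A`-adequate: the all-`A` state graph `𝔾_A` has no edge that is a loop. -/
def IsAAdequate (D : LinkDiagram X) : Prop :=
  ∀ c : X, (D.endsA c).1 ≠ (D.endsA c).2

/-- The maximum possible degree `M(D) = e(𝔾_A) + 2 v(𝔾_A) - 2` of the Kauffman bracket. -/
noncomputable def maxDegree (D : LinkDiagram X) : ℤ :=
  (Nat.card X : ℤ) + 2 * (Nat.card D.VertexA : ℤ) - 2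

/-- The coefficient `a_M(D)` of `A ^ M(D)` in the Kauffman bracket of `D`. -/
noncomputable def topCoeff [Fintype X] [DecidableEq X] (D : LinkDiagram X) : ℤ :=
  D.bracket.coeff D.maxDegree

/-! ### Parallels

Each crossing `c` of `D` becomes an `n × n` grid of crossings `(c, i, j)`.  Draw `c` such that its
half-edges `0`, `1`, `2`, `3` point south, east, north, west; then `i` counts the columns (copies
of the under-strand) from west to east and `j` counts the rows (copies of the over-strand) from
south to north.  Each half-edge of `D` becomes `n` parallel half-edges on the boundary of
the grid, which are numbered counterclockwise around the grid. -/

/-- The half-edge with number `k` among the `n` copies of the half-edge `d` of a diagram. -/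
def gridEnd {n : ℕ} (d : X × Fin 4) (k : Fin n) : (X × Fin n × Fin n) × Fin 4 :=
  match d with
  | (c, 0) => ((c, k, ⟨0, k.pos⟩), 0)
  | (c, 1) => ((c, ⟨n - 1, Nat.sub_one_lt_of_lt k.isLt⟩, k), 1)
  | (c, 2) => ((c, k.rev, ⟨n - 1, Nat.sub_one_lt_of_lt k.isLt⟩), 2)
  | (c, 3) => ((c, ⟨0, k.pos⟩, k.rev), 3)

/-- The edges of the `n`-parallel: neighbouring crossings of a grid are joined, and
each edge of `D` is replaced by `n` parallel edges.  Seen from the other end, these are numbered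
in the opposite order. -/
def parallelArc (D : LinkDiagram X) (n : ℕ) :
    (X × Fin n × Fin n) × Fin 4 → (X × Fin n × Fin n) × Fin 4
  | ((c, i, j), 0) =>
      if 0 < j.val then ((c, i, ⟨j.val - 1, by omega⟩), 2)
      else gridEnd (D.arc (c, 0)) i.rev
  | ((c, i, j), 1) =>
      if h : i.val + 1 < n then ((c, ⟨i.val + 1, h⟩, j), 3)
      else gridEnd (D.arc (c, 1)) j.rev
  | ((c, i, j), 2) =>
      if h : j.val + 1 < n then ((c, i, ⟨j.val + 1, h⟩), 0)
      else gridEnd (D.arc (c, 2)) i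
  | ((c, i, j), 3) =>
      if 0 < i.val then ((c, ⟨i.val - 1, by omega⟩, j), 1)
      else gridEnd (D.arc (c, 3)) j

theorem parallelArc_gridEnd (D : LinkDiagram X) {n : ℕ} (d : X × Fin 4) (k : Fin n) :
    D.parallelArc n (gridEnd d k) = gridEnd (D.arc d) k.rev := by
  obtain ⟨c, l⟩ := d
  have hk := k.isLt
  fin_cases l <;> simp [gridEnd, parallelArc] <;> intros <;> omega

theorem gridEnd_injective {n : ℕ} {d d' : X × Fin 4} {k k' : Fin n}
    (h : gridEnd d k = gridEnd d' k') : d = d' := by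
  obtain ⟨c, l⟩ := d
  obtain ⟨c', l'⟩ := d'
  fin_cases l <;> fin_cases l' <;> simp_all [gridEnd]

/-- A half-edge of the parallel either is on the boundary of its grid, or is joined
to a different half-edge inside the grid by an edge that joins the latter to the former. -/
theorem parallelArc_cases (D : LinkDiagram X) {n : ℕ} (x : (X × Fin n × Fin n) × Fin 4) :
    (∃ d k, x = gridEnd d k) ∨
      (D.parallelArc n (D.parallelArc n x) = x ∧ D.parallelArc n x ≠ x) := by
  obtain ⟨⟨c, i, j⟩, l⟩ := x
  have hi := i.isLt
  have hj := j.isLt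
  fin_cases l
  · by_cases h : 0 < j.val
    · right
      have h' : j.val - 1 + 1 = j.val := by omega
      simp [parallelArc, h, h']
    · left
      refine ⟨(c, 0), i, ?_⟩
      simp [gridEnd, Fin.ext_iff]; omega
  · by_cases h : i.val + 1 < n
    · right
      simp [parallelArc, h]
    · left
      refine ⟨(c, 1), j, ?_⟩
      simp [gridEnd, Fin.ext_iff]; omega
  · by_cases h : j.val + 1 < n
    · right
      simp [parallelArc, h]
    · left
      refine ⟨(c, 2), i.rev, ?_⟩
      simp [gridEnd, Fin.ext_iff]; omega
  · by_cases h : 0 < i.val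
    · right
      have h' : i.val - 1 + 1 = i.val := by omega
      simp [parallelArc, h, h']
    · left
      refine ⟨(c, 3), j.rev, ?_⟩
      simp [gridEnd, Fin.ext_iff]; omega

/-- The (blackboard) `n`-parallel `D ^ n` of the diagram `D`. -/
def parallel (D : LinkDiagram X) (n : ℕ) : LinkDiagram (X × Fin n × Fin n) where
  arc := D.parallelArc n
  arc_arc x := by
    rcases D.parallelArc_cases x with ⟨d, k, rfl⟩ | h
    · rw [parallelArc_gridEnd, parallelArc_gridEnd, D.arc_arc, Fin.rev_rev]
    · exact h.1
  arc_ne x := by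
    rcases D.parallelArc_cases x with ⟨d, k, rfl⟩ | h
    · rw [parallelArc_gridEnd]
      exact fun h => D.arc_ne d (gridEnd_injective h)
    · exact h.2
  circles := n * D.circles

end LinkDiagram

/-! A state with `b` resolutions of type `B` reaches degree `M(D)` exactly if it has `v(𝔾_A) + b`
circles, the largest possible number because a switch from `A` to `B` creates at most one circle. It
then contributes `(-1) ^ (v + b - 1)` (`topCoeff_eq`). Switching an edge of `𝔾_A` that is not a loop
merges two circles, so all `B`-crossings of such a maximal state are loops of `𝔾_A`
(`IsMaximalState.joined`). If `D` is `A`-adequate, only the all-`A` state is maximal and the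
coefficient is `±1`.

Inside a grid the arcs of the all-`A` state are staircases along the diagonal. Hence the all-`A`
circles of `D ^ n` are parallel copies of those of `D`, and `(c, i, j)` can be a loop only if `i =
j` and `c` is a loop for `D` (`joined_of_joined_parallel`). So parallels of `A`-adequate diagrams
are `A`-adequate.

Conversely let `c` be a loop for `D`. The diagonal crossings over a loop have their chords on the
outermost copy of its circle on the side of the chord. For `n > 1` the outermost copies on the two
sides differ, so all loops at one copy lie on the same side of it, and in the plane chords on one
side of a circle do not interlace (`IsPlanar.half_circle_eq`). Therefore switching the corner
crossing `(c, 0, 0)` splits a circle in every maximal state, whatever loops are already switched.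
Toggling that crossing is then a sign-reversing involution on the maximal states, and the
coefficient vanishes (`topCoeff_eq_zero`).

Planarity enters only through the vanishing of first homology modulo `2`: every cycle of the
`4`-valent graph bounds a set of faces (`IsPlanar.exists_face_coloring`). This gives the
checkerboard coloring, which tells the sides of a circle apart, and a discrete Jordan curve argument
for the chords. -/

namespace LinkDiagram

variable {X : Type*}

/-! ### Cycles of a planar code are boundaries -/

section Homology

variable (D : LinkDiagram X)

instance [Finite X] : Finite D.Edge := inferInstanceAs (Finite (Quot _))
instance [Finite X] : Finite D.Face := inferInstanceAs (Finite (Quot _))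
instance [Finite X] : Finite D.Piece := inferInstanceAs (Finite (Quot _))

/-- The edge that contains a half-edge. -/
def edge (d : X × Fin 4) : D.Edge := Quot.mk _ d

/-- The face to the right of a half-edge. -/
def face (d : X × Fin 4) : D.Face := Quot.mk _ d

/-- The connected component that contains a half-edge. -/
def piece (d : X × Fin 4) : D.Piece := Quot.mk _ d

theorem edge_arc (d : X × Fin 4) : D.edge (D.arc d) = D.edge d := by
  refine (Quot.sound ?_).symm
  rfl

theorem edge_eq_iff (d d' : X × Fin 4) : D.edge d = D.edge d' ↔ d = d' ∨ d = D.arc d' := by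
  constructor
  · intro h
    have key : ∀ e : D.Edge, e = D.edge d' → Quot.lift
        (fun x => x = d' ∨ x = D.arc d') (by
          rintro x _ rfl
          apply propext
          constructor
          · rintro (rfl | rfl)
            · exact Or.inr rfl
            · exact Or.inl (D.arc_arc _)
          · rintro (h | h)
            · exact Or.inr (by rw [← h, D.arc_arc])
            · exact Or.inl (by rw [← D.arc_arc x, h, D.arc_arc])) e := by
      rintro _ rfl
      exact Or.inl rfl
    exact key _ h
  · rintro (rfl | rfl)
    · rfl
    · exact D.edge_arc d'

theorem face_arc (c : X) (i : Fin 4) : D.face (D.arc (c, i)) = D.face (c, i + 1) := by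
  refine Quot.sound ?_
  rw [D.arc_arc]

/-- The boundary map from `2`-chains to `1`-chains. -/
def faceBoundary :
    (D.Face → ZMod 2) →ₗ[ZMod 2] (D.Edge → ZMod 2) where
  toFun g := Quot.lift (fun d => g (D.face d) + g (D.face (D.arc d))) (by
    rintro d _ rfl
    rw [D.arc_arc, add_comm])
  map_add' g h := by
    ext e
    obtain ⟨d, rfl⟩ := Quot.exists_rep e
    exact add_add_add_comm _ _ _ _
  map_smul' t g := by
    ext e
    obtain ⟨d, rfl⟩ := Quot.exists_rep e
    exact (mul_add _ _ _).symm

theorem faceBoundary_edge (g : D.Face → ZMod 2) (d : X × Fin 4) :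
    D.faceBoundary g (D.edge d) = g (D.face d) + g (D.face (D.arc d)) := rfl

open Classical in
/-- The incidence matrix of the underlying `4`-valent graph, modulo `2`. -/
noncomputable def incidence : Matrix X D.Edge (ZMod 2) :=
  fun c e => ∑ i : Fin 4, if D.edge (c, i) = e then 1 else 0

theorem incidence_mulVec [Fintype D.Edge] (a : D.Edge → ZMod 2) (c : X) :
    D.incidence.mulVec a c = ∑ i : Fin 4, a (D.edge (c, i)) := by
  classical
  simp only [Matrix.mulVec, dotProduct, incidence, Finset.sum_mul, ite_mul, one_mul, zero_mul]
  rw [Finset.sum_comm]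
  simp

theorem transpose_incidence_mulVec [Fintype X] (u : X → ZMod 2) (d : X × Fin 4) :
    D.incidence.transpose.mulVec u (D.edge d) = u d.1 + u (D.arc d).1 := by
  classical
  simp only [Matrix.mulVec, dotProduct, incidence, Matrix.transpose_apply, Finset.sum_mul, ite_mul,
    one_mul, zero_mul]
  rw [← Fintype.sum_prod_type' (f := fun c i => if D.edge (c, i) = D.edge d then u c else 0),
    ← Finset.sum_filter]
  have : (Finset.univ.filter fun x : X × Fin 4 => D.edge (x.1, x.2) = D.edge d) =
      {d, D.arc d} := by
    ext x
    simp [edge_eq_iff]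
  rw [this, Finset.sum_pair (D.arc_ne d).symm]

/-- Functions on a set of classes of half-edges, pulled back from the set of components. -/
theorem finrank_le_card_piece [Finite X] {ι : Type*} [Finite ι] (p : ι → D.Piece)
    (W : Submodule (ZMod 2) (ι → ZMod 2))
    (h : ∀ g ∈ W, ∃ u : D.Piece → ZMod 2, g = u ∘ p) :
    Module.finrank (ZMod 2) W ≤ Nat.card D.Piece := by
  have := Fintype.ofFinite D.Piece
  have := Fintype.ofFinite ι
  have hle : W ≤ LinearMap.range (LinearMap.funLeft (ZMod 2) (ZMod 2) p) := by
    intro g hg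
    obtain ⟨u, rfl⟩ := h g hg
    exact ⟨u, rfl⟩
  calc Module.finrank (ZMod 2) W
      ≤ Module.finrank (ZMod 2) (LinearMap.range (LinearMap.funLeft (ZMod 2) (ZMod 2) p)) :=
        Submodule.finrank_mono hle
    _ ≤ Module.finrank (ZMod 2) (D.Piece → ZMod 2) := LinearMap.finrank_range_le _
    _ = Nat.card D.Piece := by
        rw [Module.finrank_fintype_fun_eq_card, Nat.card_eq_fintype_card]

theorem add_eq_zero_iff_eq_zmod_two (x y : ZMod 2) : x + y = 0 ↔ x = y := by
  revert x y; decide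

theorem apply_eq_of_rotate {β : Type*} {f : X × Fin 4 → β} (h : ∀ c i, f (c, i + 1) = f (c, i))
    (c : X) (i j : Fin 4) : f (c, i) = f (c, j) := by
  have key : ∀ i : Fin 4, f (c, i) = f (c, 0) := by
    have h1 := h c 0
    have h2 := h c 1
    have h3 := h c 2
    intro i
    fin_cases i
    · rfl
    · exact h1
    · exact h2.trans h1
    · exact h3.trans (h2.trans h1)
  rw [key i, key j]

/-- Lift a function on half-edges to the components. -/
theorem exists_eq_comp_piece (f : X × Fin 4 → ZMod 2) (harc : ∀ d, f (D.arc d) = f d)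
    (hrot : ∀ c i, f (c, i + 1) = f (c, i)) :
    ∃ u : D.Piece → ZMod 2, ∀ d, f d = u (D.piece d) := by
  refine ⟨Quot.lift f ?_, fun d => rfl⟩
  rintro ⟨c, i⟩ ⟨c', i'⟩ (h | h)
  · rw [h, harc]
  · obtain rfl : c' = c := h
    exact apply_eq_of_rotate hrot _ _ _

/-- Exactness follows from a dimension count. Functions in the kernel of the face boundary, and in
the kernel of the transposed incidence matrix, are constant on components, so both kernels have
dimension at most the number of components. By Euler's formula the boundaries then have at least the
dimension of the cycles. -/
theorem range_faceBoundary [Finite X] (hD : D.IsPlanar) [Fintype D.Edge] :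
    LinearMap.range D.faceBoundary = LinearMap.ker D.incidence.mulVecLin := by
  have := Fintype.ofFinite X
  have := Fintype.ofFinite D.Face
  have := Fintype.ofFinite D.Piece
  have hle : LinearMap.range D.faceBoundary ≤ LinearMap.ker D.incidence.mulVecLin := by
    rintro _ ⟨g, rfl⟩
    rw [LinearMap.mem_ker]
    ext c
    rw [Matrix.mulVecLin_apply, incidence_mulVec]
    simp only [faceBoundary_edge, face_arc, Fin.sum_univ_four, Pi.zero_apply]
    rw [show (0 : Fin 4) + 1 = 1 from rfl, show (1 : Fin 4) + 1 = 2 from rfl,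
      show (2 : Fin 4) + 1 = 3 from rfl, show (3 : Fin 4) + 1 = 0 from rfl]
    generalize g (D.face (c, 0)) = x0
    generalize g (D.face (c, 1)) = x1
    generalize g (D.face (c, 2)) = x2
    generalize g (D.face (c, 3)) = x3
    linear_combination (x0 + x1 + x2 + x3) * (CharTwo.two_eq_zero : (2 : ZMod 2) = 0)
  refine Submodule.eq_of_le_of_finrank_le hle ?_
  have hB := LinearMap.finrank_range_add_finrank_ker D.faceBoundary
  have hZ := LinearMap.finrank_range_add_finrank_ker D.incidence.mulVecLin
  have hT := LinearMap.finrank_range_add_finrank_ker D.incidence.transpose.mulVecLin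
  have hr : D.incidence.transpose.rank = D.incidence.rank := Matrix.rank_transpose _
  unfold Matrix.rank at hr
  have hkB : Module.finrank (ZMod 2) (LinearMap.ker D.faceBoundary) ≤ Nat.card D.Piece := by
    refine D.finrank_le_card_piece (ι := D.Face) (Quot.lift D.piece ?_) _ ?_
    · rintro d _ rfl
      trans D.piece (D.arc d)
      · exact Quot.sound (by exact Or.inl rfl)
      · exact Quot.sound (by exact Or.inr rfl)
    · intro (g : D.Face → ZMod 2) hg
      have hg' : ∀ d, g (D.face (D.arc d)) = g (D.face d) := fun d => by
        have := congrFun (LinearMap.mem_ker.mp hg) (D.edge d)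
        rw [faceBoundary_edge] at this
        exact ((add_eq_zero_iff_eq_zmod_two _ _).mp this).symm
      obtain ⟨u, hu⟩ := D.exists_eq_comp_piece (fun d => g (D.face d)) hg' fun c i => by
        rw [← face_arc, hg']
      refine ⟨u, ?_⟩
      ext e
      induction e using Quot.ind
      exact hu _
  have hkT : Module.finrank (ZMod 2) (LinearMap.ker D.incidence.transpose.mulVecLin) ≤
      Nat.card D.Piece := by
    refine D.finrank_le_card_piece (fun c => D.piece (c, 0)) _ ?_
    intro v hv
    obtain ⟨u, hu⟩ := D.exists_eq_comp_piece (fun d => v d.1) (fun d => by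
      have := congrFun (LinearMap.mem_ker.mp hv) (D.edge d)
      rw [Matrix.mulVecLin_apply, transpose_incidence_mulVec] at this
      exact ((add_eq_zero_iff_eq_zmod_two _ _).mp this).symm) fun c i => rfl
    exact ⟨u, funext fun c => hu (c, 0)⟩
  unfold IsPlanar at hD
  rw [Module.finrank_fintype_fun_eq_card, ← Nat.card_eq_fintype_card] at hB hZ hT
  omega

/-- On a planar code every cycle modulo `2` of the underlying `4`-valent graph is the boundary of
a set of faces. -/
theorem IsPlanar.exists_face_coloring [Finite X] {D : LinkDiagram X} (hD : D.IsPlanar) {a : X × Fin 4 → ZMod 2}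
    (harc : ∀ d, a (D.arc d) = a d) (hsum : ∀ c, a (c, 0) + a (c, 1) + a (c, 2) + a (c, 3) = 0) :
    ∃ g : X × Fin 4 → ZMod 2,
      (∀ d, g (D.arc d) = g d + a d) ∧ ∀ c i, g (c, i + 1) = g (c, i) + a (c, i) := by
  have := Fintype.ofFinite D.Edge
  let a' : D.Edge → ZMod 2 := Quot.lift a (by rintro d _ rfl; exact (harc d).symm)
  have ha' : a' ∈ LinearMap.ker D.incidence.mulVecLin := by
    rw [LinearMap.mem_ker]
    ext c
    rw [Matrix.mulVecLin_apply, incidence_mulVec, Fin.sum_univ_four]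
    exact hsum c
  rw [← D.range_faceBoundary hD] at ha'
  obtain ⟨g, hg⟩ := ha'
  have key : ∀ d, g (D.face (D.arc d)) = g (D.face d) + a d := fun d => by
    have h1 : g (D.face d) + g (D.face (D.arc d)) = a d := by
      rw [← faceBoundary_edge, hg]; rfl
    rw [← h1, ← add_assoc, CharTwo.add_self_eq_zero, zero_add]
  exact ⟨fun d => g (D.face d), key, fun c i => by
    simp only [← face_arc, key]⟩

/-- The checkerboard coloring of a planar code. -/
theorem IsPlanar.exists_checkerboard [Finite X] {D : LinkDiagram X} (hD : D.IsPlanar) :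
    ∃ o : X × Fin 4 → ZMod 2,
      (∀ d, o (D.arc d) = o d + 1) ∧ ∀ c i, o (c, i + 1) = o (c, i) + 1 :=
  -- The sum of all edges is a cycle because every vertex has even degree.
  hD.exists_face_coloring (a := 1) (fun _ => rfl) fun _ => (by decide : (1 + 1 + 1 + 1 : ZMod 2) = 0)

end Homology

/-! ### The number of circles of a state -/

section Quotients

variable {α : Type*}

theorem mk_eq_mk_of_le {r s : α → α → Prop} (h : ∀ x y, r x y → Quot.mk s x = Quot.mk s y) {x y : α}
    (hxy : Quot.mk r x = Quot.mk r y) : Quot.mk s x = Quot.mk s y :=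
  congrArg (Quot.lift (Quot.mk s) h) hxy

open Classical in
/-- Identifying two more points lowers the number of classes by at most one. -/
theorem card_quot_eq_add [Finite α] {r s : α → α → Prop} (x y : α)
    (hrs : ∀ z w, r z w → s z w) (hxy : s x y)
    (hs : ∀ z w, s z w → Quot.mk r z = Quot.mk r w ∨
      (Quot.mk r z = Quot.mk r x ∨ Quot.mk r z = Quot.mk r y) ∧
        (Quot.mk r w = Quot.mk r x ∨ Quot.mk r w = Quot.mk r y)) :
    Nat.card (Quot r) = Nat.card (Quot s) + if Quot.mk r x = Quot.mk r y then 0 else 1 := by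
  have hr' : ∀ z w, r z w → Quot.mk s z = Quot.mk s w := fun z w h => Quot.sound (hrs z w h)
  have hmk := Quot.sound hxy
  let e : {z : Quot r // z = Quot.mk r x ∨ z ≠ Quot.mk r y} ≃ Quot s :=
    { toFun := fun z => Quot.lift (Quot.mk s) hr' z.1
      invFun := Quot.lift
        (fun z => if h : Quot.mk r z = Quot.mk r y then ⟨Quot.mk r x, Or.inl rfl⟩
          else ⟨Quot.mk r z, Or.inr h⟩) (by
            intro z w h
            have := hs z w h
            by_cases h1 : Quot.mk r z = Quot.mk r y <;> by_cases h2 : Quot.mk r w = Quot.mk r y <;>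
              simp only [h1, h2, dif_pos, dif_neg, not_false_iff, Subtype.mk.injEq] <;> grind)
      left_inv := by
        rintro ⟨z, hz⟩
        obtain ⟨z, rfl⟩ := Quot.exists_rep z
        apply Subtype.ext
        dsimp only
        split_ifs with h
        · grind
        · rfl
      right_inv := by
        intro z
        obtain ⟨z, rfl⟩ := Quot.exists_rep z
        dsimp only
        split_ifs with h
        · exact hmk.trans (mk_eq_mk_of_le hr' h.symm)
        · rfl }
  rw [← Nat.card_congr e]
  split_ifs with h
  · rw [add_zero]
    refine (Nat.card_congr (Equiv.subtypeUnivEquiv ?_)).symm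
    intro z
    rw [h]
    exact Classical.em _
  · have : ∀ z, (z = Quot.mk r x ∨ z ≠ Quot.mk r y) ↔ z ∈ ({Quot.mk r y}ᶜ : Set (Quot r)) := by
      intro z
      simp only [Set.mem_compl_iff, Set.mem_singleton_iff]
      constructor
      · rintro (rfl | h')
        · exact h
        · exact h'
      · exact Or.inr
    rw [Nat.card_congr (Equiv.subtypeEquivRight this)]
    have h2 := Set.ncard_add_ncard_compl ({Quot.mk r y} : Set (Quot r))
    rw [Set.ncard_singleton] at h2
    rw [← Nat.card_coe_set_eq] at h2
    change 1 + Nat.card {z // z ∈ ({Quot.mk r y}ᶜ : Set (Quot r))} = _ at h2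
    omega

end Quotients

/-! ### The effect of one switch on the circles of a state -/

section Circles

variable (D : LinkDiagram X)

/-- The relation that defines the state circles. -/
def StateRel (σ : X → Bool) (d d' : X × Fin 4) : Prop :=
  d' = D.arc d ∨ d' = (d.1, splice (σ d.1) d.2)

/-- The relation that defines the state circles, together with the identification of all half-edges
at the crossing `c`. -/
def StateRelAt (σ : X → Bool) (c : X) (d d' : X × Fin 4) : Prop :=
  d' = D.arc d ∨ d' = (d.1, splice (σ d.1) d.2) ∨ d.1 = c ∧ d'.1 = c

/-- `d` and `d'` are on the same circle of the state `σ`. -/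
def Joined (σ : X → Bool) (d d' : X × Fin 4) : Prop :=
  Quot.mk (D.StateRel σ) d = Quot.mk (D.StateRel σ) d'

variable {D}

theorem Joined.symm {σ : X → Bool} {d d' : X × Fin 4} (h : D.Joined σ d d') : D.Joined σ d' d :=
  Eq.symm h

theorem Joined.trans {σ : X → Bool} {d d' d'' : X × Fin 4} (h : D.Joined σ d d')
    (h' : D.Joined σ d' d'') : D.Joined σ d d'' :=
  Eq.trans h h'

theorem joined_arc (σ : X → Bool) (d : X × Fin 4) : D.Joined σ (D.arc d) d :=
  (Quot.sound (by exact Or.inl rfl)).symm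

theorem joined_splice (σ : X → Bool) (c : X) (i : Fin 4) :
    D.Joined σ (c, splice (σ c) i) (c, i) :=
  (Quot.sound (by exact Or.inr rfl)).symm

/-- A function that is constant on the circles. -/
theorem Joined.apply_eq {β : Type*} {σ : X → Bool} {d d' : X × Fin 4} (h : D.Joined σ d d')
    (f : X × Fin 4 → β) (harc : ∀ d, f (D.arc d) = f d)
    (hspl : ∀ c i, f (c, splice (σ c) i) = f (c, i)) : f d = f d' := by
  refine congrArg (Quot.lift f ?_) h
  rintro ⟨c, i⟩ _ (rfl | rfl)
  · exact (harc _).symm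
  · exact (hspl _ _).symm

theorem stateCircle_eq_iff (σ : X → Bool) (d d' : X × Fin 4) :
    D.stateCircle σ d = D.stateCircle σ d' ↔ D.Joined σ d d' :=
  Sum.inl_injective.eq_iff

theorem isAAdequate_iff : D.IsAAdequate ↔ ∀ c, ¬ D.Joined allA (c, 0) (c, 2) :=
  forall_congr' fun _ => not_congr (stateCircle_eq_iff _ _ _)

variable (D)

instance [Finite X] (σ : X → Bool) : Finite (D.StateCircle σ) :=
  inferInstanceAs (Finite (Quot _ ⊕ _))

theorem card_stateCircle [Finite X] (σ : X → Bool) :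
    Nat.card (D.StateCircle σ) = Nat.card (Quot (D.StateRel σ)) + D.circles := by
  change Nat.card (Quot (D.StateRel σ) ⊕ Fin D.circles) = _
  rw [Nat.card_sum, Nat.card_fin]

theorem card_stateCircle_pos [Finite X] (hD : D.IsNonempty) (σ : X → Bool) :
    0 < Nat.card (D.StateCircle σ) := by
  rw [card_stateCircle]
  rcases hD with ⟨⟨c⟩⟩ | h
  · have : Nonempty (Quot (D.StateRel σ)) := ⟨Quot.mk _ (c, 0)⟩
    have : 0 < Nat.card (Quot (D.StateRel σ)) := Nat.card_pos
    omega
  · omega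

open Classical in
theorem card_quot_stateRel [Finite X] (σ : X → Bool) (c : X) :
    Nat.card (Quot (D.StateRel σ)) = Nat.card (Quot (D.StateRelAt σ c)) +
      if D.Joined σ (c, 0) (c, if σ c then 2 else 1) then 0 else 1 := by
  refine card_quot_eq_add _ _ ?_ (Or.inr (Or.inr ⟨rfl, rfl⟩)) ?_
  · rintro z w (h | h)
    · exact Or.inl h
    · exact Or.inr (Or.inl h)
  -- The splice pairs the four half-edges at `c`, so they meet at most two circles, and identifying
  -- them costs at most one class.
  · have key : ∀ i : Fin 4, D.Joined σ (c, i) (c, 0) ∨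
        D.Joined σ (c, i) (c, if σ c then 2 else 1) := by
      intro i
      have h := D.joined_splice σ c i
      have hr : D.Joined σ (c, i) (c, i) := rfl
      cases hc : σ c <;> rw [hc] at h <;> fin_cases i <;> first
        | exact Or.inl hr
        | exact Or.inr hr
        | exact Or.inl h.symm
        | exact Or.inr h.symm
    rintro ⟨z, i⟩ ⟨w, j⟩ (h | h | ⟨hz, hw⟩)
    · exact Or.inl (Quot.sound (Or.inl h))
    · exact Or.inl (Quot.sound (Or.inr h))
    · obtain rfl : z = c := hz
      obtain rfl : w = z := hw
      exact Or.inr ⟨key i, key j⟩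

variable [DecidableEq X]

/-- Once the four half-edges at `c` are identified, the resolution at `c` no longer matters. This
common quotient is the link between the circle counts of `σ` and `τ`. -/
theorem quot_stateRelAt_congr {σ τ : X → Bool} {c : X} (h : ∀ c', c' ≠ c → σ c' = τ c') :
    Nat.card (Quot (D.StateRelAt σ c)) = Nat.card (Quot (D.StateRelAt τ c)) := by
  congr 2
  ext d d'
  unfold StateRelAt
  by_cases hd : d.1 = c
  · have : ∀ b, (d' = (d.1, splice b d.2)) → d'.1 = c := by
      rintro b rfl
      exact hd
    have h1 := this (σ d.1)
    have h2 := this (τ d.1)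
    tauto
  · rw [h _ hd]

open Classical in
/-- Comparison of the numbers of circles of two states that differ at one crossing only. -/
theorem card_stateCircle_switch [Finite X] {σ τ : X → Bool} {c : X}
    (h : ∀ c', c' ≠ c → σ c' = τ c') (hσ : σ c = true) (hτ : τ c = false) :
    Nat.card (D.StateCircle τ) + (if D.Joined σ (c, 0) (c, 2) then 0 else 1) =
      Nat.card (D.StateCircle σ) + if D.Joined τ (c, 0) (c, 1) then 0 else 1 := by
  have h1 := D.card_quot_stateRel σ c
  have h2 := D.card_quot_stateRel τ c
  have h3 := D.quot_stateRelAt_congr h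
  rw [hσ] at h1
  rw [hτ] at h2
  simp only [if_true, Bool.false_eq_true, if_false] at h1 h2
  rw [card_stateCircle, card_stateCircle]
  omega

/-- If the `A`-resolution of a crossing has its two arcs on different circles, then switching to
the `B`-resolution merges them. -/
theorem joined_of_not_joined [Finite X] {σ τ : X → Bool} {c : X} (h : ∀ c', c' ≠ c → σ c' = τ c')
    (hσ : σ c = true) (hτ : τ c = false) (hn : ¬ D.Joined σ (c, 0) (c, 2)) :
    D.Joined τ (c, 0) (c, 1) := by
  classical
  by_contra hn'
  have := Fintype.ofFinite X
  -- Parity argument: `K` consists of the half-edges that share both their `σ`-circle and their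
  -- `τ`-circle with `(c, 0)`. The involution `arc` shows that `K` is even. If `(c, 0)` is the only
  -- half-edge at `c` in `K`, the splices away from `c` show that `K` without it is even too.
  let K : Finset (X × Fin 4) :=
    Finset.univ.filter fun d => D.Joined σ d (c, 0) ∧ D.Joined τ d (c, 0)
  have hK : ∀ d, d ∈ K ↔ D.Joined σ d (c, 0) ∧ D.Joined τ d (c, 0) := fun d => by simp [K]
  have h0 : (c, 0) ∈ K := (hK _).mpr ⟨rfl, rfl⟩
  have heven : Even K.card := by
    rw [even_iff_two_dvd, ← ZMod.natCast_eq_zero_iff, Finset.card_eq_sum_ones, Nat.cast_sum]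
    refine Finset.sum_involution (fun d _ => D.arc d) ?_ ?_ ?_ ?_
    · intros; decide
    · intro d _ _
      exact D.arc_ne d
    · intro d hd
      have := (hK d).mp hd
      exact (hK _).mpr ⟨(D.joined_arc σ d).trans this.1, (D.joined_arc τ d).trans this.2⟩
    · intro d _
      exact D.arc_arc d
  have hc : ∀ i : Fin 4, (c, i) ∈ K → i = 0 := by
    intro i hi
    obtain ⟨h1, h2⟩ := (hK _).mp hi
    have j1 := D.joined_splice σ c i
    have j2 := D.joined_splice τ c i
    rw [hσ] at j1
    rw [hτ] at j2
    fin_cases i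
    · rfl
    · exact absurd h2.symm hn'
    · exact absurd h1.symm hn
    · exact absurd (j1.trans h1).symm hn
  have hodd : Even (K.erase (c, 0)).card := by
    rw [even_iff_two_dvd, ← ZMod.natCast_eq_zero_iff, Finset.card_eq_sum_ones, Nat.cast_sum]
    have hspl : ∀ (b : Bool) (i : Fin 4), splice b i ≠ i ∧ splice b (splice b i) = i := by decide
    refine Finset.sum_involution (fun d _ => (d.1, splice (σ d.1) d.2)) ?_ ?_ ?_ ?_
    · intros; decide
    · rintro ⟨c', i⟩ _ _ h
      exact (hspl (σ c') i).1 (Prod.ext_iff.mp h).2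
    · rintro ⟨c', i⟩ hd
      obtain ⟨hd0, hd⟩ := Finset.mem_erase.mp hd
      obtain ⟨h1, h2⟩ := (hK _).mp hd
      have hne : c' ≠ c := by
        rintro rfl
        exact hd0 (by rw [hc i hd])
      refine Finset.mem_erase.mpr ⟨fun h => hne (Prod.ext_iff.mp h).1, (hK _).mpr ⟨?_, ?_⟩⟩
      · exact (D.joined_splice σ c' i).trans h1
      · dsimp only
        rw [h _ hne]
        exact (D.joined_splice τ c' i).trans h2
    · rintro ⟨c', i⟩ _
      exact Prod.ext rfl (hspl (σ c') i).2
  rw [Finset.card_erase_of_mem h0] at hodd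
  have := Finset.card_pos.mpr ⟨_, h0⟩
  rw [Nat.even_iff] at hodd heven
  omega

end Circles

/-! ### The top coefficient of the bracket -/

section TopCoeff

theorem coeff_mul_T (p : ℤ[T;T⁻¹]) (m n : ℤ) :
    (p * LaurentPolynomial.T n).coeff m = p.coeff (m - n) := by
  have := AddMonoidAlgebra.coeff_mul_single_apply p (1 : ℤ) n m
  rw [mul_one, ← sub_eq_add_neg] at this
  exact this

theorem coeff_T_mul (p : ℤ[T;T⁻¹]) (m n : ℤ) :
    (LaurentPolynomial.T n * p).coeff m = p.coeff (m - n) := by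
  rw [mul_comm, coeff_mul_T]

theorem coeff_loop_pow (k : ℕ) : ∀ m : ℤ, 2 * (k : ℤ) ≤ m →
    ((-LaurentPolynomial.T 2 - LaurentPolynomial.T (-2) : ℤ[T;T⁻¹]) ^ k).coeff m =
      if m = 2 * (k : ℤ) then (-1) ^ k else 0 := by
  induction k with
  | zero =>
    intro m hm
    rw [pow_zero, pow_zero, ← LaurentPolynomial.T_zero, LaurentPolynomial.T_apply]
    simp [eq_comm]
  | succ k ih =>
    intro m hm
    push_cast at hm
    rw [pow_succ, mul_sub, mul_neg, AddMonoidAlgebra.coeff_sub, AddMonoidAlgebra.coeff_neg,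
      Finsupp.sub_apply, Finsupp.neg_apply, coeff_mul_T, coeff_mul_T, ih _ (by omega),
      ih _ (by omega), if_neg (by omega : ¬ m - -2 = 2 * (k : ℤ)), sub_zero]
    push_cast
    by_cases h : m = 2 * ((k : ℤ) + 1)
    · rw [if_pos h, if_pos (by omega), pow_succ, mul_neg_one]
    · rw [if_neg h, if_neg (by omega), neg_zero]

variable [Fintype X]

/-- The crossings with `B`-resolution. -/
def crossingsB (σ : X → Bool) : Finset X := Finset.univ.filter fun c => σ c = false

theorem mem_crossingsB {σ : X → Bool} {c : X} : c ∈ crossingsB σ ↔ σ c = false := by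
  simp [crossingsB]

theorem crossingsB_allA : crossingsB (allA : X → Bool) = ∅ := by
  ext c
  simp [mem_crossingsB, allA]

variable (D : LinkDiagram X)

/-- Every switch of the state `σ` from `A` to `B` has produced a new circle. -/
def IsMaximalState (σ : X → Bool) : Prop :=
  Nat.card (D.StateCircle σ) = Nat.card D.VertexA + (crossingsB σ).card

theorem isMaximalState_allA : D.IsMaximalState allA := by
  unfold IsMaximalState
  rw [crossingsB_allA, Finset.card_empty, add_zero]

variable [DecidableEq X]

theorem crossingsB_update_false (σ : X → Bool) (c : X) :
    crossingsB (Function.update σ c false) = insert c (crossingsB σ) := by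
  ext c'
  rw [Finset.mem_insert, mem_crossingsB, mem_crossingsB]
  by_cases h : c' = c
  · subst h
    simp
  · simp [h]

theorem crossingsB_update_true (σ : X → Bool) (c : X) :
    crossingsB (Function.update σ c true) = (crossingsB σ).erase c := by
  ext c'
  rw [Finset.mem_erase, mem_crossingsB, mem_crossingsB]
  by_cases h : c' = c
  · subst h
    simp
  · simp [h]

/-- Switching a crossing from `A` to `B` produces at most one more circle. -/
theorem card_stateCircle_add_le (τ : X → Bool) : ∀ σ : X → Bool, crossingsB τ ⊆ crossingsB σ →
    Nat.card (D.StateCircle σ) + (crossingsB τ).card ≤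
      Nat.card (D.StateCircle τ) + (crossingsB σ).card := by
  intro σ
  induction h : (crossingsB σ).card generalizing σ with
  | zero =>
    intro hs
    rw [Finset.card_eq_zero] at h
    have hτ : crossingsB τ = ∅ := Finset.subset_empty.mp (h ▸ hs)
    have : σ = τ := by
      funext c
      have h1 := mem_crossingsB (σ := σ) (c := c)
      have h2 := mem_crossingsB (σ := τ) (c := c)
      rw [h] at h1
      rw [hτ] at h2
      simp at h1 h2
      rw [h1, h2]
    rw [this, hτ, Finset.card_empty]
  | succ k ih =>
    intro hs
    by_cases hsub : crossingsB σ ⊆ crossingsB τ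
    · have hB := hsub.antisymm hs
      have : σ = τ := by
        funext c
        have h1 := mem_crossingsB (σ := σ) (c := c)
        rw [hB, mem_crossingsB] at h1
        cases h2 : σ c <;> cases h3 : τ c <;> simp_all
      subst this
      omega
    · obtain ⟨c, hc, hc'⟩ := Finset.not_subset.mp hsub
      have hup := crossingsB_update_true σ c
      have hIH := ih (Function.update σ c true)
        (by rw [hup, Finset.card_erase_of_mem hc, h, Nat.add_sub_cancel])
        (by rw [hup]; exact Finset.subset_erase.mpr ⟨hs, hc'⟩)
      classical
      have hsw := D.card_stateCircle_switch (σ := Function.update σ c true) (τ := σ) (c := c)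
        (fun c' hne => Function.update_of_ne hne _ _) (Function.update_self _ _ _)
        (mem_crossingsB.mp hc)
      split_ifs at hsw <;> omega

theorem card_stateCircle_le (σ : X → Bool) :
    Nat.card (D.StateCircle σ) ≤ Nat.card D.VertexA + (crossingsB σ).card := by
  have := D.card_stateCircle_add_le allA σ (by rw [crossingsB_allA]; exact Finset.empty_subset _)
  rwa [crossingsB_allA, Finset.card_empty, add_zero] at this

variable {D}

/-- In a maximal state all crossings with `B`-resolution are loops of the all-`A` state graph. -/
theorem IsMaximalState.joined {σ : X → Bool} (h : D.IsMaximalState σ) {c : X} (hc : σ c = false) :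
    D.Joined allA (c, 0) (c, 2) := by
  classical
  by_contra hn
  have h1 := D.card_stateCircle_add_le (Function.update allA c false) σ (by
    rw [crossingsB_update_false, crossingsB_allA]
    simpa using mem_crossingsB.mpr hc)
  have hagree : ∀ c', c' ≠ c → allA c' = Function.update allA c false c' :=
    fun c' hne => (Function.update_of_ne hne _ _).symm
  have h2 := D.card_stateCircle_switch hagree rfl (Function.update_self _ _ _)
  rw [if_neg hn, if_pos (D.joined_of_not_joined hagree rfl (Function.update_self _ _ _) hn)] at h2
  rw [crossingsB_update_false, crossingsB_allA, insert_empty_eq, Finset.card_singleton] at h1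
  unfold IsMaximalState at h
  change _ = Nat.card D.VertexA + 0 at h2
  omega

-- The top degree of the term of `σ` is `a(σ) - b(σ) + 2 (|σ| - 1) = e - 2 b(σ) + 2 |σ| - 2`. It
-- equals `M(D)` exactly for `|σ| = v + b(σ)` and is smaller otherwise, by `card_stateCircle_le`.
open Classical in
theorem topCoeff_eq (hD : D.IsNonempty) :
    D.topCoeff = ∑ σ : X → Bool, if D.IsMaximalState σ then
      (-1) ^ (Nat.card D.VertexA + (crossingsB σ).card - 1) else 0 := by
  unfold topCoeff bracket
  rw [AddMonoidAlgebra.coeff_sum, Finsupp.finsetSum_apply]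
  refine Finset.sum_congr rfl fun σ _ => ?_
  have hpos := D.card_stateCircle_pos hD σ
  have hle := D.card_stateCircle_le σ
  have hexp : (∑ c : X, if σ c then (1 : ℤ) else -1) =
      Nat.card X - 2 * ((crossingsB σ).card : ℤ) := by
    have : ∀ c, (if σ c then (1 : ℤ) else -1) = 1 - 2 * if σ c = false then 1 else 0 := by
      intro c
      cases σ c <;> simp
    simp only [this, Finset.sum_sub_distrib, ← Finset.mul_sum, crossingsB, Finset.card_filter]
    simp
  rw [hexp, coeff_T_mul]
  unfold maxDegree
  rw [coeff_loop_pow _ _ (by omega)]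
  unfold IsMaximalState
  by_cases h : Nat.card (D.StateCircle σ) = Nat.card D.VertexA + (crossingsB σ).card
  · rw [if_pos h, if_pos (by omega), h]
  · rw [if_neg h, if_neg (by omega)]

theorem IsAAdequate.topCoeff_ne_zero (hD : D.IsNonempty) (h : D.IsAAdequate) :
    D.topCoeff ≠ 0 := by
  classical
  rw [topCoeff_eq hD, Finset.sum_eq_single allA]
  · rw [if_pos D.isMaximalState_allA]
    exact pow_ne_zero _ (by decide)
  · intro σ _ hσ
    refine if_neg fun hmax => ?_
    obtain ⟨c, hc⟩ := Function.ne_iff.mp hσ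
    exact isAAdequate_iff.mp h c (hmax.joined (by simpa [allA] using hc))
  · exact fun h => absurd (Finset.mem_univ _) h

/-- If a crossing can be switched to `B` with a gain of one circle in every maximal state, then
the contributions to the top coefficient cancel in pairs. -/
theorem topCoeff_eq_zero (hD : D.IsNonempty) (c : X)
    (h : ∀ σ, D.IsMaximalState σ → ¬ D.Joined (Function.update σ c false) (c, 0) (c, 1)) :
    D.topCoeff = 0 := by
  classical
  rw [topCoeff_eq hD]
  -- Toggling `c` preserves maximality: forwards since the switch gains a circle by hypothesis,
  -- backwards since a switch gains at most one.
  have key : ∀ σ, σ c = true →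
      (D.IsMaximalState σ ↔ D.IsMaximalState (Function.update σ c false)) := by
    intro σ hσ
    have hagree : ∀ c', c' ≠ c → σ c' = Function.update σ c false c' :=
      fun c' hne => (Function.update_of_ne hne _ _).symm
    have hsw := D.card_stateCircle_switch hagree hσ (Function.update_self _ _ _)
    have hj := D.joined_of_not_joined hagree hσ (Function.update_self _ _ _)
    have hle := D.card_stateCircle_le σ
    have hcard : (crossingsB (Function.update σ c false)).card = (crossingsB σ).card + 1 := by
      rw [crossingsB_update_false, Finset.card_insert_of_notMem]
      simp [mem_crossingsB, hσ]
    constructor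
    · intro hmax
      have hn := h σ hmax
      have hj' : D.Joined σ (c, 0) (c, 2) := by
        by_contra hn'
        exact hn (hj hn')
      rw [if_neg hn, if_pos hj'] at hsw
      unfold IsMaximalState at hmax ⊢
      omega
    · intro hmax
      unfold IsMaximalState at hmax ⊢
      split_ifs at hsw <;> omega
  refine Finset.sum_involution (fun σ _ => Function.update σ c (!σ c)) ?_ ?_ ?_ ?_
  · intro σ _
    have aux : ∀ τ : X → Bool, τ c = true →
        ((if D.IsMaximalState τ then
            (-1 : ℤ) ^ (Nat.card D.VertexA + (crossingsB τ).card - 1) else 0) +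
          if D.IsMaximalState (Function.update τ c false) then
            (-1) ^ (Nat.card D.VertexA + (crossingsB (Function.update τ c false)).card - 1)
          else 0) = 0 := by
      intro τ hτ
      rw [crossingsB_update_false, Finset.card_insert_of_notMem (by simp [mem_crossingsB, hτ])]
      have hpos : 0 < Nat.card D.VertexA := D.card_stateCircle_pos hD _
      by_cases hm : D.IsMaximalState τ
      · rw [if_pos hm, if_pos ((key τ hτ).mp hm),
          show Nat.card D.VertexA + ((crossingsB τ).card + 1) - 1 =
            (Nat.card D.VertexA + (crossingsB τ).card - 1) + 1 by omega, pow_succ]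
        ring
      · rw [if_neg hm, if_neg (fun h' => hm ((key τ hτ).mpr h')), add_zero]
    cases hσ : σ c
    · have := aux (Function.update σ c true) (Function.update_self _ _ _)
      rw [Function.update_idem, ← hσ, Function.update_eq_self, add_comm] at this
      exact this
    · exact aux σ hσ
  · intro σ _ _ hσ
    have := congrFun hσ c
    rw [Function.update_self] at this
    exact Bool.not_ne_self _ this
  · exact fun _ _ => Finset.mem_univ _
  · intro σ _
    simp

end TopCoeff

/-! ### Loops of the all-`A` state graph of a planar code -/

section Loops

theorem add_one_eq_iff_ne_zmod_two (x y : ZMod 2) : x + 1 = y ↔ x ≠ y := by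
  revert x y; decide

/-- Up to the first visit of `y`, the orbit of `x` does not return to `x`. -/
theorem exists_orbit_segment {α : Type*} [Finite α] (p : Equiv.Perm α) {x y : α} (hxy : x ≠ y)
    (h : p.SameCycle x y) :
    ∃ Y : Set α, x ∈ Y ∧ y ∉ Y ∧ (∀ d, p d = x → d ∉ Y) ∧ (∀ d, p d = y → d ∈ Y) ∧
      ∀ d, p d ≠ x → p d ≠ y → (p d ∈ Y ↔ d ∈ Y) := by
  classical
  have hex : ∃ k : ℕ, (p ^ k) x = y := by
    obtain ⟨k, -, hk⟩ := h.exists_pow_eq'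
    exact ⟨k, hk⟩
  obtain ⟨k, hk, hmin⟩ : ∃ k : ℕ, (p ^ k) x = y ∧ ∀ i < k, (p ^ i) x ≠ y :=
    ⟨Nat.find hex, Nat.find_spec hex, fun i hi => Nat.find_min hex hi⟩
  have hk0 : 0 < k := by
    rcases Nat.eq_zero_or_pos k with rfl | h0
    · exact absurd hk hxy
    · exact h0
  have hsucc : ∀ (i : ℕ), (p ^ (i + 1)) x = p ((p ^ i) x) := fun i => by
    rw [pow_succ', Equiv.Perm.mul_apply]
  refine ⟨{d | ∃ i < k, (p ^ i) x = d}, ⟨0, hk0, rfl⟩, ?_, ?_, ?_, ?_⟩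
  · rintro ⟨i, hi, h⟩
    exact hmin i hi h
  · rintro d hd ⟨i, hi, rfl⟩
    rw [← hsucc] at hd
    refine hmin (k - (i + 1)) (by omega) ?_
    rw [← hk]
    conv_lhs => rw [← hd]
    rw [← Equiv.Perm.mul_apply, ← pow_add, Nat.sub_add_cancel hi]
  · intro d hd
    refine ⟨k - 1, by omega, p.injective ?_⟩
    rw [← hsucc, Nat.sub_add_cancel hk0, hk, hd]
  · intro d hx hy
    constructor
    · rintro ⟨i, hi, h⟩
      cases i with
      | zero => exact absurd h.symm hx
      | succ i =>
        refine ⟨i, by omega, p.injective ?_⟩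
        rw [← hsucc, h]
    · rintro ⟨i, hi, rfl⟩
      rw [← hsucc] at hx hy ⊢
      refine ⟨i + 1, ?_, rfl⟩
      by_contra hlt
      obtain rfl : i + 1 = k := by omega
      exact hy hk

variable (D : LinkDiagram X)

/-- The other end of the arc of the `A`-resolution. -/
def spliceA (d : X × Fin 4) : X × Fin 4 := (d.1, splice true d.2)

theorem spliceA_spliceA (d : X × Fin 4) : spliceA (spliceA d) = d :=
  Prod.ext rfl ((by decide : ∀ i, splice true (splice true i) = i) d.2)

/-- Going along an edge and then along an arc of the `A`-resolution. -/
def stepA : Equiv.Perm (X × Fin 4) where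
  toFun d := spliceA (D.arc d)
  invFun d := D.arc (spliceA d)
  left_inv d := by simp only [spliceA_spliceA, D.arc_arc]
  right_inv d := by simp only [D.arc_arc, spliceA_spliceA]

theorem stepA_apply (d : X × Fin 4) : D.stepA d = spliceA (D.arc d) := rfl

variable {D}

theorem apply_spliceA {o : X × Fin 4 → ZMod 2} (horot : ∀ c i, o (c, i + 1) = o (c, i) + 1)
    (d : X × Fin 4) : o (spliceA d) = o d + 1 := by
  obtain ⟨c, i⟩ := d
  have h0 := horot c 0
  have h2 := horot c 2
  have h2' : ∀ x y : ZMod 2, x = y + 1 → y = x + 1 := by decide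
  fin_cases i
  · exact h0
  · exact h2' _ _ h0
  · exact h2
  · exact h2' _ _ h2

/-- Half of the state circle through both ends of a loop of the all-`A` state graph. -/
theorem exists_half_circle [Finite X] {o : X × Fin 4 → ZMod 2}
    (hoarc : ∀ d, o (D.arc d) = o d + 1) (horot : ∀ c i, o (c, i + 1) = o (c, i) + 1) {c : X}
    (hc : D.Joined allA (c, 0) (c, 2)) :
    ∃ a : X × Fin 4 → ZMod 2, (∀ d, a (D.arc d) = a d) ∧
      (∀ c', c' ≠ c → a (c', 1) = a (c', 0) ∧ a (c', 3) = a (c', 2)) ∧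
      a (c, 0) = 0 ∧ a (c, 1) = 1 ∧ a (c, 2) = 1 ∧ a (c, 3) = 0 := by
  classical
  have hospl := apply_spliceA horot
  -- Both `arc` and the splice change the color `o`, so `stepA` preserves it. Choosing from each
  -- edge the half-edge with the color of `(c, 1)` orients all state circles coherently, and `stepA`
  -- moves along them.
  let out (d : X × Fin 4) : X × Fin 4 := if o d = o (c, 1) then d else D.arc d
  have hout : ∀ d, o d = o (c, 1) → out d = d := fun d h => if_pos h
  have hin : ∀ d, o d ≠ o (c, 1) → out d = D.arc d := fun d h => if_neg h
  have hflip : ∀ x y : ZMod 2, x + 1 = y ↔ x ≠ y := add_one_eq_iff_ne_zmod_two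
  have houtarc : ∀ d, out (D.arc d) = out d := by
    intro d
    by_cases h : o d = o (c, 1)
    · rw [hout d h, hin, D.arc_arc]
      rw [hoarc, ne_eq, hflip, not_not]
      exact h
    · rw [hin d h, hout]
      rw [hoarc, hflip]
      exact h
  have hstep : ∀ d, o d ≠ o (c, 1) → out (spliceA d) = D.stepA (out d) := by
    intro d h
    rw [hin d h, stepA_apply, D.arc_arc, hout]
    rw [hospl, hflip]
    exact h
  -- The splice is an involution that changes the color, so invariance need only be checked from one
  -- color.
  have hspl_of : ∀ P : X × Fin 4 → Prop, ∀ d,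
      (∀ d', d'.1 = d.1 → o d' ≠ o (c, 1) → (P (spliceA d') ↔ P d')) →
        (P (spliceA d) ↔ P d) := by
    intro P d hP
    by_cases h : o d = o (c, 1)
    · have := hP (spliceA d) rfl (by
        rw [hospl, ne_eq, hflip, not_not]
        exact h)
      rw [spliceA_spliceA] at this
      exact this.symm
    · exact hP d rfl h
  have hosucc := horot c
  have h2 : o (c, 3) = o (c, 1) := by
    have h1 := hosucc 1
    have h2 := hosucc 2
    rw [show (2 : Fin 4) + 1 = 3 from rfl] at h2
    rw [show (1 : Fin 4) + 1 = 2 from rfl] at h1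
    rw [h2, h1, add_assoc, show (1 + 1 : ZMod 2) = 0 from rfl, add_zero]
  have h0 : o (c, 0) ≠ o (c, 1) := (hflip _ _).mp (hosucc 0).symm
  have h2' : o (c, 2) ≠ o (c, 1) := by
    rw [← h2]
    exact (hflip _ _).mp (hosucc 2).symm
  have hcycle : D.stepA.SameCycle (c, 1) (c, 3) := by
    have hj : D.Joined allA (c, 1) (c, 3) :=
      ((D.joined_splice allA c 0).trans hc).trans (D.joined_splice allA c 2).symm
    have := hj.apply_eq (fun d => D.stepA.SameCycle (c, 1) (out d)) (fun d => by rw [houtarc])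
      fun c' i => propext (hspl_of (fun d => D.stepA.SameCycle (c, 1) (out d)) (c', i)
        fun d' _ h => by rw [hstep d' h, Equiv.Perm.sameCycle_apply_right])
    rw [hout _ rfl, hout _ h2] at this
    exact this.mp (Equiv.Perm.SameCycle.refl _ _)
  -- `Y` runs from `(c, 1)` up to, but not including, `(c, 3)`. The steps into these two points come
  -- from the edges at `(c, 0)` and `(c, 2)`, which are therefore outside and inside `Y`.
  obtain ⟨Y, hx, hy, hpx, hpy, hp⟩ :=
    exists_orbit_segment D.stepA (fun h => absurd (Prod.ext_iff.mp h).2 (by decide : (1 : Fin 4) ≠ 3)) hcycle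
  have hYstep : ∀ d, d.1 ≠ c → (out (spliceA d) ∈ Y ↔ out d ∈ Y) := by
    intro d hd
    refine hspl_of (fun d => out d ∈ Y) d fun d' hd' h => ?_
    have h1 : D.stepA (out d') = spliceA d' := by rw [hin d' h, stepA_apply, D.arc_arc]
    rw [hstep d' h]
    refine hp _ ?_ ?_ <;> rw [h1] <;> intro he <;>
      exact hd (hd'.symm.trans (congrArg Prod.fst he))
  have h30 : out (c, 0) ∉ Y := hpx _ (by rw [hin _ h0, stepA_apply, D.arc_arc]; rfl)
  have h12 : out (c, 2) ∈ Y := hpy _ (by rw [hin _ h2', stepA_apply, D.arc_arc]; rfl)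
  refine ⟨fun d => if out d ∈ Y then 1 else 0, fun d => by simp only [houtarc], fun c' hc' => ⟨?_, ?_⟩,
    if_neg h30, if_pos (by rwa [hout _ rfl]), if_pos h12, if_neg (by rwa [hout _ h2])⟩
  · exact if_congr (hYstep (c', 0) hc') rfl rfl
  · exact if_congr (hYstep (c', 2) hc') rfl rfl

/-- On a planar code, the half of a state circle that is cut off by a loop `c` of the all-`A` state
graph contains both ends or no end of any other loop on the same side. -/
theorem IsPlanar.half_circle_eq [Finite X] (hD : D.IsPlanar) {o a : X × Fin 4 → ZMod 2}
    (hoarc : ∀ d, o (D.arc d) = o d + 1) (horot : ∀ c i, o (c, i + 1) = o (c, i) + 1) {c : X}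
    (harc : ∀ d, a (D.arc d) = a d)
    (ha : ∀ c', c' ≠ c → a (c', 1) = a (c', 0) ∧ a (c', 3) = a (c', 2))
    (h0 : a (c, 0) = 0) (h1 : a (c, 1) = 1) (h2 : a (c, 2) = 1) (h3 : a (c, 3) = 0)
    {c' : X} (hside : o (c', 0) = o (c, 0)) (hc' : D.Joined allA (c', 0) (c', 2)) :
    a (c', 0) = a (c', 3) ∧ a (c', 1) = a (c', 2) := by
  have htwo : ∀ x : ZMod 2, x + x = 0 := by decide
  -- The half circle closes up through the crossing `c` to a cycle, so it bounds a set of faces with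
  -- indicator `g`.
  obtain ⟨g, hgarc, hgrot⟩ := hD.exists_face_coloring harc fun e => by
    by_cases he : e = c
    · subst he
      rw [h0, h1, h2, h3]
      rfl
    · obtain ⟨e1, e2⟩ := ha e he
      rw [e1, e2, htwo, zero_add, htwo]
  have hflip := add_one_eq_iff_ne_zmod_two
  -- The expression is the value of `g` on that face along the edge whose color differs from `o (c,
  -- 0)`, the face on the side away from the chord `c`. It stays constant along all-`A` circles: an
  -- arc either stays beside one such face, or passes between two with equal `g`, because `a` agrees
  -- on both ends of the arc.
  have hpair : ∀ e (i : Fin 4), i = 0 ∨ i = 2 →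
      (g (e, i + 1) + if o (e, i + 1) = o (c, 0) then a (e, i + 1) else 0) =
        g (e, i) + if o (e, i) = o (c, 0) then a (e, i) else 0 := by
    intro e i hi
    rw [hgrot, horot]
    simp only [hflip, ne_eq]
    by_cases he : e = c
    · have ho : o (e, i) = o (c, 0) := by
        subst he
        rcases hi with rfl | rfl
        · rfl
        · have e0 := horot e 0
          have e1 := horot e 1
          rw [show (1 : Fin 4) + 1 = 2 from rfl] at e1
          rw [show (0 : Fin 4) + 1 = 1 from rfl] at e0
          rw [e1, e0, add_assoc, htwo, add_zero]
      rw [if_neg (not_not.mpr ho), if_pos ho, add_zero]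
    · obtain ⟨e1, e2⟩ := ha e he
      have : a (e, i + 1) = a (e, i) := by
        rcases hi with rfl | rfl
        · exact e1
        · exact e2
      rw [this]
      by_cases ho : o (e, i) = o (c, 0)
      · rw [if_neg (not_not.mpr ho), if_pos ho, add_zero]
      · rw [if_pos ho, if_neg ho, add_assoc, htwo]
  have hr := hc'.apply_eq (fun d => g d + if o d = o (c, 0) then a d else 0)
    (fun d => by
      rw [hgarc, hoarc, harc]
      simp only [hflip, ne_eq]
      by_cases ho : o d = o (c, 0)
      · rw [if_neg (not_not.mpr ho), if_pos ho, add_zero]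
      · rw [if_pos ho, if_neg ho, add_assoc, htwo])
    (fun e i => by
      fin_cases i
      · exact hpair e 0 (Or.inl rfl)
      · exact (hpair e 0 (Or.inl rfl)).symm
      · exact hpair e 2 (Or.inr rfl)
      · exact (hpair e 2 (Or.inr rfl)).symm)
  by_cases he : c' = c
  · subst he
    rw [h0, h1, h2, h3]
    exact ⟨rfl, rfl⟩
  · obtain ⟨e1, e2⟩ := ha c' he
    have o1 := horot c' 0
    have o2 := horot c' 1
    have g1 := hgrot c' 0
    have g2 := hgrot c' 1
    rw [show (0 : Fin 4) + 1 = 1 from rfl] at o1 g1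
    rw [show (1 : Fin 4) + 1 = 2 from rfl] at o2 g2
    have ho : o (c', 2) = o (c, 0) := by rw [o2, o1, add_assoc, htwo, add_zero, hside]
    have hg : g (c', 2) = g (c', 0) := by rw [g2, g1, e1, add_assoc, htwo, add_zero]
    rw [if_pos hside, if_pos ho, hg] at hr
    have := add_left_cancel hr
    exact ⟨this.trans e2.symm, e1.trans this⟩

end Loops

/-! ### State circles of the parallels -/

section Parallel

variable {β : Type*} {n : ℕ}

/-- Extend a function `F`, given on the copies `k < n` of the half-edges of a diagram, to all
half-edges of its `n`-parallel, so that it is constant on the parts of the all-`A` state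
circles inside the grids, except for the half-edges at which these enter the grids
from the sides `0` and `3`. -/
def extendGrid (F : X × Fin 4 → ℕ → β) : (X × Fin n × Fin n) × Fin 4 → β
  | ((c, i, j), 0) =>
      if j.val ≤ i.val then
        if j.val = 0 then F (c, 0) i.val else F (c, 1) (n - 1 - (i.val - j.val))
      else F (c, 2) (j.val - i.val - 1)
  | ((c, i, j), 1) =>
      if j.val ≤ i.val then F (c, 1) (n - 1 - (i.val - j.val)) else F (c, 2) (j.val - i.val - 1)
  | ((c, i, j), 2) =>
      if j.val < i.val then F (c, 1) (n - 1 - (i.val - j.val - 1)) else F (c, 2) (j.val - i.val)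
  | ((c, i, j), 3) =>
      if j.val < i.val then F (c, 1) (n - 1 - (i.val - j.val - 1))
      else if i.val = 0 then F (c, 3) (n - 1 - j.val) else F (c, 2) (j.val - i.val)

theorem extendGrid_gridEnd (F : X × Fin 4 → ℕ → β) (d : X × Fin 4) (k : Fin n) :
    extendGrid F (gridEnd d k) = F d k := by
  obtain ⟨c, l⟩ := d
  have hk := k.isLt
  fin_cases l
  · simp [gridEnd, extendGrid]
  · simp only [gridEnd, extendGrid]
    rw [if_pos (by omega)]
    congr 1
    omega
  · simp only [gridEnd, extendGrid, Fin.val_rev]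
    rw [if_neg (by omega)]
    congr 1
    omega
  · simp only [gridEnd, extendGrid, Fin.val_rev]
    rw [if_neg (by omega), if_pos trivial]
    congr 1
    omega

variable (D : LinkDiagram X)

theorem extendGrid_arc {F : X × Fin 4 → ℕ → β}
    (hF : ∀ d k, k < n → F (D.arc d) (n - 1 - k) = F d k) (x : (X × Fin n × Fin n) × Fin 4) :
    extendGrid F ((D.parallel n).arc x) = extendGrid F x := by
  change extendGrid F (D.parallelArc n x) = _
  obtain ⟨⟨c, i, j⟩, l⟩ := x
  have hi := i.isLt
  have hj := j.isLt
  have hrev : ∀ k : Fin n, k.rev.val = n - 1 - k.val := fun k => by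
    rw [Fin.val_rev]; omega
  fin_cases l
  · by_cases h : 0 < j.val
    · simp only [parallelArc, if_pos h, extendGrid]
      split_ifs <;> first | contradiction | omega | (congr 1 <;> omega)
    · simp only [parallelArc, if_neg h]
      rw [extendGrid_gridEnd, hrev, hF _ _ hi]
      simp only [extendGrid]
      rw [if_pos (by omega), if_pos (by omega)]
  · by_cases h : i.val + 1 < n
    · simp only [parallelArc, dif_pos h, extendGrid]
      split_ifs <;> first | contradiction | omega | (congr 1 <;> omega)
    · simp only [parallelArc, dif_neg h]
      rw [extendGrid_gridEnd, hrev, hF _ _ hj]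
      simp only [extendGrid]
      rw [if_pos (by omega)]
      congr 1
      omega
  · by_cases h : j.val + 1 < n
    · simp only [parallelArc, dif_pos h, extendGrid]
      split_ifs <;> first | contradiction | omega | (congr 1 <;> omega)
    · simp only [parallelArc, dif_neg h]
      rw [extendGrid_gridEnd]
      simp only [extendGrid]
      rw [if_neg (by omega), ← hF (c, 2) _ (by omega)]
      congr 1
      omega
  · by_cases h : 0 < i.val
    · simp only [parallelArc, if_pos h, extendGrid]
      split_ifs <;> first | contradiction | omega | (congr 1 <;> omega)
    · simp only [parallelArc, if_neg h]
      rw [extendGrid_gridEnd]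
      simp only [extendGrid]
      rw [if_neg (by omega), if_pos (by omega), ← hF (c, 3) _ (by omega)]
      congr 1
      omega

/-- The staircases run from side `0` to side `1` below the diagonal and from side `3` to side `2`
above it. Their values are read off at sides `1` and `2`, so a mismatch between the two ends can
only show at the first crossing, where `j = 0` or `i = 0`. -/
theorem extendGrid_splice {F : X × Fin 4 → ℕ → β} {c : X} {i j : Fin n}
    (h0 : j.val = 0 → F (c, 0) i.val = F (c, 1) (n - 1 - i.val))
    (h3 : i.val = 0 → F (c, 3) (n - 1 - j.val) = F (c, 2) j.val) (l : Fin 4) :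
    extendGrid F ((c, i, j), splice true l) = extendGrid F ((c, i, j), l) := by
  have h01 : extendGrid F ((c, i, j), 0) = extendGrid F ((c, i, j), 1) := by
    simp only [extendGrid]
    split_ifs with h h'
    · rw [h0 h', h', Nat.sub_zero]
    · rfl
    · rfl
  have h32 : extendGrid F ((c, i, j), 3) = extendGrid F ((c, i, j), 2) := by
    simp only [extendGrid]
    split_ifs with h h'
    · rfl
    · rw [h3 h', h', Nat.sub_zero]
    · rfl
  fin_cases l
  · exact h01.symm
  · exact h01
  · exact h32
  · exact h32.symm

/-! ### Loops of the all-`A` state graph of a parallel -/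

variable {D}

/-- The loops of the all-`A` state graph of a parallel are on the diagonals of the grids of
the loops of the all-`A` state graph of the diagram. -/
theorem joined_of_joined_parallel {o : X × Fin 4 → ZMod 2}
    (hoarc : ∀ d, o (D.arc d) = o d + 1) (horot : ∀ c i, o (c, i + 1) = o (c, i) + 1)
    {c : X} {i j : Fin n} (h : (D.parallel n).Joined allA ((c, i, j), 0) ((c, i, j), 2)) :
    i = j ∧ D.Joined allA (c, 0) (c, 2) := by
  have hflip := add_one_eq_iff_ne_zmod_two
  have hi := i.isLt
  have hj := j.isLt
  -- The numbering of the copies reverses along edges and arcs, as does the color `o`. Correcting by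
  -- the color gives a copy number that is constant along a state circle.
  let F (d : X × Fin 4) (k : ℕ) : ℤ × Quot (D.StateRel allA) :=
    (if o d = 0 then (k : ℤ) else n - 1 - k, Quot.mk _ d)
  have hrev : ∀ (d d' : X × Fin 4) (k : ℕ), k < n → o d' = o d + 1 → D.Joined allA d' d →
      F d' (n - 1 - k) = F d k := by
    intro d d' k hk ho hj
    refine Prod.ext ?_ hj
    change (if o d' = 0 then ((n - 1 - k : ℕ) : ℤ) else n - 1 - (n - 1 - k : ℕ)) =
      if o d = 0 then (k : ℤ) else n - 1 - k
    rw [ho]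
    simp only [hflip, ne_eq]
    by_cases h : o d = 0
    · rw [if_neg (not_not.mpr h), if_pos h]
      omega
    · rw [if_pos h, if_neg h]
      omega
  have key := h.apply_eq (extendGrid F)
    (D.extendGrid_arc fun d k hk => hrev _ _ _ hk (hoarc d) (D.joined_arc _ d))
    (by
      rintro ⟨c', i', j'⟩ l
      have hi' := i'.isLt
      have hj' := j'.isLt
      refine extendGrid_splice (fun _ => ?_) (fun _ => ?_) l
      · exact (hrev _ _ _ hi' (horot c' 0) (D.joined_splice allA c' 0)).symm
      · exact hrev _ _ _ hj' (horot c' 2) (D.joined_splice allA c' 2))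
  have key' := (extendGrid_splice (F := F) (c := c) (i := i) (j := j)
    (fun _ => (hrev _ _ _ hi (horot c 0) (D.joined_splice allA c 0)).symm)
    (fun _ => hrev _ _ _ hj (horot c 2) (D.joined_splice allA c 2)) 0).trans key
  change extendGrid F ((c, i, j), 1) = extendGrid F ((c, i, j), 2) at key'
  simp only [extendGrid] at key'
  have hne : ∀ d (k k' : ℕ), F d k = F d k' → k = k' := by
    intro d k k' h
    have h1 : (if o d = 0 then (k : ℤ) else n - 1 - k) = if o d = 0 then (k' : ℤ) else n - 1 - k' :=
      congrArg Prod.fst h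
    split_ifs at h1 <;> omega
  -- Off the diagonal the two arcs lie on neighbouring staircases over the same half-edge, hence on
  -- different copies.
  split_ifs at key' with h1 h2 h2
  · have := hne _ _ _ key'
    omega
  · have h3 : D.Joined allA (c, 1) (c, 2) := congrArg Prod.snd key'
    exact ⟨Fin.ext (by omega), (D.joined_splice allA c 0).symm.trans h3⟩
  · omega
  · have := hne _ _ _ key'
    omega

theorem IsNonempty.parallel (hD : D.IsNonempty) (hn : 0 < n) : (D.parallel n).IsNonempty := by
  rcases hD with ⟨⟨c⟩⟩ | h
  · exact Or.inl ⟨(c, ⟨0, hn⟩, ⟨0, hn⟩)⟩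
  · exact Or.inr (Nat.mul_pos hn h)

theorem IsAAdequate.parallel [Finite X] (hD : D.IsPlanar) (h : D.IsAAdequate) (n : ℕ) :
    (D.parallel n).IsAAdequate := by
  obtain ⟨o, hoarc, horot⟩ := hD.exists_checkerboard
  rw [isAAdequate_iff] at h ⊢
  rintro ⟨c, i, j⟩ hj
  exact h c (joined_of_joined_parallel hoarc horot hj).2

/-! ### Vanishing of the top coefficient for diagrams that are not `A`-adequate -/

variable [Fintype X] [DecidableEq X]

/-- In a parallel with more than one strand, the outermost copies of the loops on one side of a
circle have pairwise disjoint chords, so that the top coefficient vanishes. -/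
theorem topCoeff_parallel_eq_zero (hD : D.IsPlanar) (hne : D.IsNonempty) (h : ¬ D.IsAAdequate)
    (hn : 1 < n) : (D.parallel n).topCoeff = 0 := by
  rw [isAAdequate_iff] at h
  push Not at h
  obtain ⟨c, hc⟩ := h
  obtain ⟨o, hoarc, horot⟩ := hD.exists_checkerboard
  obtain ⟨a, harc, ha, h0, h1, h2, h3⟩ := exists_half_circle hoarc horot hc
  have hflip := add_one_eq_iff_ne_zmod_two
  have hloop : ∀ c', o (c', 0) = o (c, 0) → D.Joined allA (c', 0) (c', 2) →
      a (c', 0) = a (c', 3) ∧ a (c', 1) = a (c', 2) := fun c' =>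
    hD.half_circle_eq hoarc horot harc ha h0 h1 h2 h3
  have ho1 : ∀ c', o (c', 1) = o (c', 0) + 1 := fun c' => horot c' 0
  have ho2 : ∀ c', o (c', 2) = o (c', 0) := fun c' => by
    rw [show o (c', 2) = o (c', 1) + 1 from horot c' 1, ho1, add_assoc,
      show (1 + 1 : ZMod 2) = 0 from rfl, add_zero]
  have ho3 : ∀ c', o (c', 3) = o (c', 0) + 1 := fun c' => by
    rw [show o (c', 3) = o (c', 2) + 1 from horot c' 2, ho2]
  -- The half circle `a`, drawn only on the outermost copies on the side of the chord `c`. These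
  -- carry the diagonal crossings over loops of this color.
  let F (d : X × Fin 4) (k : ℕ) : ZMod 2 :=
    if (if o d = o (c, 0) then k = 0 else k = n - 1) then a d else 0
  have hF : ∀ (d d' : X × Fin 4) (k : ℕ), k < n → o d' = o d + 1 →
      ((if o d = o (c, 0) then k = 0 else k = n - 1) → a d' = a d) →
      F d' (n - 1 - k) = F d k := by
    intro d d' k hk ho had
    change (if (if o d' = o (c, 0) then n - 1 - k = 0 else n - 1 - k = n - 1) then a d' else 0) =
      if (if o d = o (c, 0) then k = 0 else k = n - 1) then a d else 0
    have hiff : (if o d' = o (c, 0) then n - 1 - k = 0 else n - 1 - k = n - 1) ↔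
        if o d = o (c, 0) then k = 0 else k = n - 1 := by
      rw [ho]
      simp only [hflip, ne_eq]
      by_cases h : o d = o (c, 0)
      · rw [if_neg (not_not.mpr h), if_pos h]
        omega
      · rw [if_pos h, if_neg h]
        omega
    by_cases hcond : if o d = o (c, 0) then k = 0 else k = n - 1
    · rw [if_pos hcond, if_pos (hiff.mpr hcond), had hcond]
    · rw [if_neg hcond, if_neg (fun h => hcond (hiff.mp h))]
  have hpos : 0 < n := by omega
  -- At the corner `(c, 0, 0)` the staircases next to the diagonal enter from sides `0` and `3`, so
  -- this is where `extendGrid` puts both jumps of `a` at `c`. With the corner resolved as `B` the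
  -- extension is constant on circles, yet it separates the half-edges `0` and `1` there.
  refine topCoeff_eq_zero (hne.parallel hpos) (c, ⟨0, hpos⟩, ⟨0, hpos⟩) fun σ hσ hj => ?_
  have key := hj.apply_eq (extendGrid F)
    (D.extendGrid_arc fun d k hk => hF _ _ _ hk (hoarc d) fun _ => harc d) (by
      rintro ⟨c', i, j⟩ l
      have hi := i.isLt
      have hj := j.isLt
      cases hs : Function.update σ (c, ⟨0, hpos⟩, ⟨0, hpos⟩) false (c', i, j)
      · have hdiag : i = j ∧ D.Joined allA (c', 0) (c', 2) := by
          by_cases he : (c', i, j) = (c, ⟨0, hpos⟩, ⟨0, hpos⟩)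
          · simp only [Prod.mk.injEq] at he
            obtain ⟨rfl, rfl, rfl⟩ := he
            exact ⟨rfl, hc⟩
          · rw [Function.update_of_ne he] at hs
            exact joined_of_joined_parallel hoarc horot (hσ.joined hs)
        obtain ⟨rfl, hcj⟩ := hdiag
        -- A loop on the side of `c` does not interlace with `c`, so `a` agrees across its `B`-arcs.
        -- A loop on the other side lies on the opposite outermost copy, where `F` is zero; this
        -- needs `0 ≠ n - 1`.
        have h03 : F (c', 0) 0 = F (c', 3) (n - 1) := by
          refine (hF _ _ _ hpos (ho3 c') ?_).symm
          by_cases hs : o (c', 0) = o (c, 0)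
          · exact fun _ => (hloop c' hs hcj).1.symm
          · rw [if_neg hs]
            omega
        have h12 : F (c', 1) (n - 1) = F (c', 2) 0 := by
          refine hF _ _ _ hpos (by rw [ho1, ho2]) ?_
          rw [ho2]
          by_cases hs : o (c', 0) = o (c, 0)
          · exact fun _ => (hloop c' hs hcj).2
          · rw [if_neg hs]
            omega
        have e03 : extendGrid F ((c', i, i), 0) = extendGrid F ((c', i, i), 3) := by
          simp only [extendGrid, le_refl, lt_irrefl, if_true, if_false, Nat.sub_self, Nat.sub_zero]
          split_ifs with hi0
          · rw [hi0, Nat.sub_zero, h03]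
          · exact h12
        have e12 : extendGrid F ((c', i, i), 1) = extendGrid F ((c', i, i), 2) := by
          simp only [extendGrid, le_refl, lt_irrefl, if_true, if_false, Nat.sub_self, Nat.sub_zero]
          exact h12
        fin_cases l
        · exact e03.symm
        · exact e12.symm
        · exact e12
        · exact e03
      -- An `A`-resolved crossing is not the corner of `c`, so its splice never meets a jump of `a`.
      · have hne' : c' = c → i.val = 0 → j.val = 0 → False := by
          rintro rfl hi0 hj0
          obtain rfl : i = ⟨0, hpos⟩ := Fin.ext hi0
          obtain rfl : j = ⟨0, hpos⟩ := Fin.ext hj0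
          rw [Function.update_self] at hs
          exact absurd hs (by decide)
        refine extendGrid_splice (fun hj0 => ?_) (fun hi0 => ?_) l
        · refine (hF _ _ _ hi (ho1 c') fun hk => ?_).symm
          by_cases he : c' = c
          · subst he
            rw [if_pos rfl] at hk
            exact (hne' rfl hk hj0).elim
          · exact (ha c' he).1
        · refine hF _ _ _ hj (by rw [ho3, ho2]) fun hk => ?_
          by_cases he : c' = c
          · subst he
            rw [ho2, if_pos rfl] at hk
            exact (hne' rfl hi0 hk).elim
          · exact (ha c' he).2)
  have e0 : extendGrid F ((c, (⟨0, hpos⟩ : Fin n), (⟨0, hpos⟩ : Fin n)), 0) = a (c, 0) := by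
    simp [extendGrid, F]
  have e1 : extendGrid F ((c, (⟨0, hpos⟩ : Fin n), (⟨0, hpos⟩ : Fin n)), 1) = a (c, 1) := by
    have : o (c, 1) ≠ o (c, 0) := by
      rw [ho1, ne_eq, hflip, not_not]
    simp [extendGrid, F, this]
  rw [e0, e1, h0, h1] at key
  exact absurd key (by decide)

end Parallel

end LinkDiagram

theorem lemma2p4 {X : Type*} [Fintype X] [DecidableEq X] (D : LinkDiagram X)
    (hplanar : D.IsPlanar) (hne : D.IsNonempty) :
    ((∃ n : ℕ, 1 < n ∧ (D.parallel n).topCoeff ≠ 0) ↔ D.IsAAdequate) ∧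
      (¬ D.IsAAdequate ↔ ∀ n : ℕ, 1 < n → (D.parallel n).topCoeff = 0) := by
  have key : (∃ n : ℕ, 1 < n ∧ (D.parallel n).topCoeff ≠ 0) ↔ D.IsAAdequate := by
    constructor
    · rintro ⟨n, hn, h⟩
      by_contra hA
      exact h (LinkDiagram.topCoeff_parallel_eq_zero hplanar hne hA hn)
    · intro hA
      exact ⟨2, one_lt_two, (hA.parallel hplanar 2).topCoeff_ne_zero (hne.parallel two_pos)⟩
  refine ⟨key, ?_⟩
  rw [← key]
  push Not
  rfl
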